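/- Let $v\ge 0$ and $e\ge 0$ be integers, let $\mathcal G(v,e)$ be the set of simple graphs with $v$ vertices and $e$ edges, and call $G\in\mathcal G(v,e)$ optimal if it maximizes the sum of the squares of the vertex degrees over $\mathcal G(v,e)$. Let $\mathrm{Dis}(v,e)$ be the set of partitions $\pi=(a_0,a_1,\dots,a_p)$ of $e$ with $v>a_0>a_1>\dots>a_p>0$ (the empty partition being allowed when $e=0$). For $\pi\in\mathrm{Dis}(v,e)$ let the threshold graph $\mathrm{Th}(\pi)\in\mathcal G(v,e)$ be the graph on $\{0,1,\dots,v-1\}$ in which, for $s<t$, the vertices $s$ and $t$ are adjacent if and only if $s\le p$ and $t\le s+a_s$ (row $s$ of the upper-triangular part of its adjacency matrix is left-justified with $a_s$ ones). The diagonal sequence of $\pi$, and of any graph isomorphic to $\mathrm{Th}(\pi)$, is $\delta(\pi)=(\delta_1,\delta_2,\dots)$, where $\delta_r$ is the number of edges $\{s,t\}$ of $\mathrm{Th}(\pi)$ with $s+t=r$. For an integer $n$ with $0\le n\le\binom v2$ write $n=\binom{k+1}2-j$ with the unique integers $1\le j\le k$. The quasi-complete graph $\mathrm{QC}(v,n)$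 is the graph on $\{1,\dots,v\}$ formed by the complete graph on $\{1,\dots,k\}$ and the edges $\{1,k+1\},\{2,k+1\},\dots,\{k-j,k+1\}$, all other vertices being isolated (for $n=0$ it is the graph with no edges). For $0\le e\le\binom v2$ the quasi-star graph $\mathrm{QS}(v,e)$ is the complement of $\mathrm{QC}\bigl(v,\binom v2-e\bigr)$. Theorem. Let $G$ be an optimal graph in $\mathcal G(v,e)$. Then $G$ is isomorphic to $\mathrm{Th}(\pi)$ for some $\pi\in\mathrm{Dis}(v,e)$, and the diagonal sequence $\delta(\pi)$ is equal to the diagonal sequence of $\mathrm{QS}(v,e)$ or to that of $\mathrm{QC}(v,e)$ (or to both). -/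

import Mathlib

/-- The class `𝒢(v,e)` of all simple graphs with the `v` vertices `0, …, v - 1` and with `e` edges. -/
def graphClass (v e : ℕ) : Set (SimpleGraph (Fin v)) :=
  {G | G.edgeSet.ncard = e}

open scoped Classical in
/-- `P₂(G)`, the sum of the squares of the degrees of the vertices of `G`. -/
noncomputable def sumSqDegrees {v : ℕ} (G : SimpleGraph (Fin v)) : ℕ :=
  ∑ i, G.degree i ^ 2

/-- `G` is optimal in `𝒢(v,e)`: it lies in `𝒢(v,e)` and `P₂(G)` is maximum there. -/
def IsOptimal (v e : ℕ) (G : SimpleGraph (Fin v)) : Prop :=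
  G ∈ graphClass v e ∧ ∀ H ∈ graphClass v e, sumSqDegrees H ≤ sumSqDegrees G

/-- `Dis(v,e)`: the partitions `π = (a₀, a₁, …, aₚ)` of `e` with `v > a₀ > a₁ > ⋯ > aₚ > 0`,
as lists in decreasing order. -/
def distinctPartitions (v e : ℕ) : Set (List ℕ) :=
  {π | π.Pairwise (fun a b => b < a) ∧ (∀ a ∈ π, 0 < a ∧ a < v) ∧ π.sum = e}

/-- `Th(π)` on `v` vertices: row `s` (counted from `0`) of the upper-triangular part of the
adjacency matrix starts with `aₛ` ones, in the columns `s + 1, …, s + aₛ`, followed by zeros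
(`aₛ` is read as `0` when `π` has no such part). -/
def thresholdGraph (v : ℕ) (π : List ℕ) : SimpleGraph (Fin v) where
  Adj i j := (i < j ∧ (j : ℕ) ≤ i + π.getD i 0) ∨ (j < i ∧ (i : ℕ) ≤ j + π.getD j 0)
  symm := ⟨fun _ _ h => h.symm⟩
  loopless := ⟨fun i h => by simp at h⟩

open scoped Classical in
/-- The diagonal sequence `δ(π) = (δ₁, δ₂, …)`, continued by zeros. Here `δₜ` is the number of ones
of the upper-triangular part of the adjacency matrix of `Th(π)` on the `t`-th diagonal line. With
rows and columns counted from `0`, that line consists of the positions `(i, j)` with `i < j` and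
`i + j = t`. (There is no line `t = 0`, and the value there is `0`.) -/
noncomputable def diagonalSequence (v : ℕ) (π : List ℕ) (t : ℕ) : ℕ :=
  (Finset.univ.filter (fun p : Fin v × Fin v =>
    p.1 < p.2 ∧ (thresholdGraph v π).Adj p.1 p.2 ∧ (p.1 : ℕ) + (p.2 : ℕ) = t)).card

/-- `δ` is the diagonal sequence of the graph `G ∈ 𝒢(v,e)`: `G` is, up to isomorphism, the
threshold graph `Th(σ)` of some `σ ∈ Dis(v,e)`, and `δ = δ(σ)`. -/
def IsDiagonalSequenceOf (v e : ℕ) (δ : ℕ → ℕ) (G : SimpleGraph (Fin v)) : Prop :=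
  ∃ σ ∈ distinctPartitions v e,
    Nonempty (G ≃g thresholdGraph v σ) ∧ δ = diagonalSequence v σ

/-- The `k` in the unique representation `e = (k+1 choose 2) - j` with `1 ≤ j ≤ k`. -/
def quasiK (e : ℕ) : ℕ := Nat.findGreatest (fun k => k.choose 2 ≤ e) (e + 1)

/-- The `j` in the unique representation `e = (k+1 choose 2) - j` with `1 ≤ j ≤ k`. -/
def quasiJ (e : ℕ) : ℕ := (quasiK e + 1).choose 2 - e

/-- The defining property of `k` and `j`, and their uniqueness. -/
theorem quasiK_quasiJ_iff (e k j : ℕ) :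
    (1 ≤ j ∧ j ≤ k ∧ e + j = (k + 1).choose 2) ↔ (k = quasiK e ∧ j = quasiJ e) := by
  have hc : ∀ n : ℕ, (n + 1).choose 2 = n + n.choose 2 := fun n => by
    rw [Nat.choose_succ_succ' n 1, Nat.choose_one_right]
  have hmono : ∀ {a b : ℕ}, a ≤ b → a.choose 2 ≤ b.choose 2 := fun h => Nat.choose_le_choose 2 h
  have hle : ∀ n : ℕ, n ≤ (n + 1).choose 2 := fun n => by rw [hc]; omega
  have h1 : (quasiK e).choose 2 ≤ e :=
    Nat.findGreatest_spec (P := fun k => k.choose 2 ≤ e) (m := 0) (by omega) (by simp)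
  have h2 : e < (quasiK e + 1).choose 2 := by
    by_contra! h
    by_cases hb : quasiK e + 1 ≤ e + 1
    · have := Nat.le_findGreatest (P := fun k => k.choose 2 ≤ e) hb h
      change quasiK e + 1 ≤ quasiK e at this
      omega
    · have := hle (quasiK e)
      omega
  have h3 := hc (quasiK e)
  constructor
  · rintro ⟨hj, hjk, he⟩
    have h4 := hc k
    have hk : k = quasiK e := by
      rcases lt_trichotomy k (quasiK e) with h | h | h
      · have := hmono (show k + 1 ≤ quasiK e from h)
        omega
      · exact h
      · have := hmono (show quasiK e + 1 ≤ k from h)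
        omega
    refine ⟨hk, ?_⟩
    subst hk
    unfold quasiJ
    omega
  · rintro ⟨rfl, rfl⟩
    unfold quasiJ
    omega

/-- The quasi-complete graph `QC(v,e)`. With `e = (k+1 choose 2) - j`, `1 ≤ j ≤ k`, and vertices
counted from `0`: the complete graph on `0, …, k - 1`, together with the edges joining the vertex
`k` to `0, …, k - j - 1`; the remaining vertices are isolated. -/
def quasiCompleteGraph (v e : ℕ) : SimpleGraph (Fin v) where
  Adj a b := a ≠ b ∧
    (((a : ℕ) < quasiK e ∧ (b : ℕ) < quasiK e) ∨
      ((a : ℕ) < quasiK e - quasiJ e ∧ (b : ℕ) = quasiK e) ∨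
      ((b : ℕ) < quasiK e - quasiJ e ∧ (a : ℕ) = quasiK e))
  symm := ⟨fun _ _ h => ⟨h.1.symm, by tauto⟩⟩
  loopless := ⟨fun _ h => h.1 rfl⟩

/-- The quasi-star graph `QS(v,e)`: the complement of `QC(v,e')`, where `e' = (v choose 2) - e`. -/
def quasiStarGraph (v e : ℕ) : SimpleGraph (Fin v) :=
  (quasiCompleteGraph v (v.choose 2 - e))ᶜ

/-!
An optimal graph is a threshold graph: if the degree of `x` is at least that of `y`, each neighbour
`b ≠ x` of `y` is adjacent to `x`, for otherwise replacing the edge `y b` by `x b` would increase the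
sum of the squares (`IsOptimal.adj_of_degree_le`). Hence there is always an isolated or a
dominating vertex, and the graph is built up by adding such vertices one at a time
(`NestedNeighbors.exists_iso_buildGraph`); the sizes at which a dominating vertex is added are the
parts of the partition `π`.

For a threshold graph in its standard form, the sum of the squares of the degrees is twice the sum of
`s + t` over all edges `{s, t}` (`sumSqDegrees_buildGraph`). The multiset of these sums, called
`weights` below, carries the same information as the diagonal sequence (`diagonalSequence_parts`).
Taking the complement acts on it in a simple way (`weights_add_map_compl`), so the complement of an
optimal graph is optimal, and equality of diagonal sequences is passed on to complements.

It remains to see that weights of maximal sum are those of a quasi-complete graph or of the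
complement of one (`MaximalWeight.exists_stair`). Remove the last added vertex. What is left is again
optimal, so that induction applies. Passing to the complement if necessary, assume that the removed
vertex `n` is dominating. If the rest looks like a quasi-star graph, so does the whole. If the rest
looks like a quasi-complete graph, with a complete graph on `c` vertices and an incomplete column,
then edges are moved from the end of row `0` to the column. Optimality implies that this is no gain,
and then either the result is quasi-complete with the same weights, or `2 * c + 1 ≤ n`
(`MaximalWeight.stair_or_le`). In the second case the quasi-complete graph is small compared with `n`
and can be improved by moving edges to row `0` (`MaximalWeight.lt_three`), except when it has at
most three edges. Then it has the weights of a star, and the whole graph those of a quasi-star graph.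
-/

/-! ### Sums over the edges of threshold graphs -/

theorem two_mul_sum_Ico_add (a b : ℕ) (h : a ≤ b) :
    2 * (Multiset.Ico a b).sum + a * a + b = b * b + a := by
  induction b, h using Nat.le_induction with
  | base => simp
  | succ b hb ih =>
    rw [← Multiset.Ico_add_Ico_eq_Ico hb (Nat.le_succ b)]
    have : Multiset.Ico b (b + 1) = {b} := by
      exact congrArg Finset.val (Nat.Ico_succ_singleton b)
    rw [this, Multiset.sum_add, Multiset.sum_singleton]
    nlinarith

theorem card_multiset_Ico (a b : ℕ) : (Multiset.Ico a b).card = b - a :=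
  Nat.card_Ico a b

open scoped Classical in
/-- The multiset of the sums `s + t` over all edges `{s, t}` of the threshold graph on `v` vertices
whose partition has the positive elements of `A` below `v` as its parts. A largest part `v` fills
the positions `(0, 1), …, (0, v)` of the first row; the remaining rows form the diagram of the other
parts moved by one row and one column, which raises every sum by `2`. The element `0` of `A`, if
present, contributes nothing. -/
noncomputable def weights : ℕ → Set ℕ → Multiset ℕ
  | 0, _ => 0
  | v + 1, A =>
    if v ∈ A then Multiset.Ico 1 (v + 1) + (weights v A).map (· + 2) else weights v A

theorem weights_succ_of_mem {v : ℕ} {A : Set ℕ} (h : v ∈ A) :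
    weights (v + 1) A = Multiset.Ico 1 (v + 1) + (weights v A).map (· + 2) := by
  simp [weights, h]

theorem weights_succ_of_notMem {v : ℕ} {A : Set ℕ} (h : v ∉ A) :
    weights (v + 1) A = weights v A := by
  simp [weights, h]

@[simp] theorem weights_zero (A : Set ℕ) : weights 0 A = 0 := rfl

@[simp] theorem weights_one (A : Set ℕ) : weights 1 A = 0 := by
  by_cases h : 0 ∈ A <;> simp [weights, h]

theorem weights_congr {v : ℕ} {A B : Set ℕ} (h : ∀ x, 0 < x → x < v → (x ∈ A ↔ x ∈ B)) :
    weights v A = weights v B := by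
  induction v with
  | zero => rfl
  | succ v ih =>
    rcases Nat.eq_zero_or_pos v with rfl | hv
    · simp
    have ih := ih fun x h0 hx => h x h0 (by omega)
    by_cases hA : v ∈ A
    · rw [weights_succ_of_mem hA, weights_succ_of_mem ((h v hv (by omega)).1 hA), ih]
    · rw [weights_succ_of_notMem hA, weights_succ_of_notMem (mt (h v hv (by omega)).2 hA), ih]

theorem weights_eq_of_le {v w : ℕ} {A : Set ℕ} (hvw : v ≤ w)
    (h : ∀ x, v ≤ x → x < w → x ∉ A) : weights w A = weights v A := by
  induction w, hvw using Nat.le_induction with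
  | base => rfl
  | succ w hw ih =>
    rw [weights_succ_of_notMem (h w hw (by omega)), ih fun x h1 h2 => h x h1 (by omega)]

theorem lt_of_mem_weights {v : ℕ} {A : Set ℕ} {t : ℕ} (h : t ∈ weights v A) : t + 3 ≤ 2 * v := by
  induction v generalizing t with
  | zero => simp at h
  | succ v ih =>
    by_cases hA : v ∈ A
    · rw [weights_succ_of_mem hA, Multiset.mem_add, Multiset.mem_Ico, Multiset.mem_map] at h
      rcases h with h | ⟨s, hs, rfl⟩
      · omega
      · have := ih hs
        omega
    · rw [weights_succ_of_notMem hA] at h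
      have := ih h
      omega

/-- The complete graph on `n + 1` vertices arises from the one on `n` vertices by adding the column
with the positions `(0, n), …, (n - 1, n)`. The definition of `weights` adds a row instead. -/
theorem weights_univ_succ (n : ℕ) :
    weights (n + 1) Set.univ = weights n Set.univ + Multiset.Ico n (2 * n) := by
  induction n with
  | zero => simp
  | succ n ih =>
    rw [weights_succ_of_mem (Set.mem_univ _)]
    conv_lhs => rw [ih]
    rw [Multiset.map_add, Multiset.map_add_right_Ico, weights_succ_of_mem (Set.mem_univ n),
      ← Multiset.Ico_add_Ico_eq_Ico (show 1 ≤ n + 1 by omega) (show n + 1 ≤ n + 1 + 1 by omega)]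
    rcases Nat.eq_zero_or_pos n with rfl | hn
    · simp
    rw [← Multiset.Ico_add_Ico_eq_Ico (show n + 1 ≤ n + 1 + 1 by omega)
      (show n + 1 + 1 ≤ 2 * (n + 1) by omega)]
    rw [show 2 * n + 2 = 2 * (n + 1) by ring]
    abel

/-- Complementation reverses the order of the vertices of a threshold graph, and hence replaces a
sum `t` by `2 * (v - 1) - t`. -/
theorem weights_add_map_compl (v : ℕ) (A : Set ℕ) :
    weights v A + (weights v Aᶜ).map (2 * v - 2 - ·) = weights v Set.univ := by
  induction v with
  | zero => simp
  | succ v ih =>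
    by_cases hA : v ∈ A
    · rw [weights_succ_of_mem hA, weights_succ_of_notMem (by simpa using hA),
        weights_succ_of_mem (Set.mem_univ v), ← ih, Multiset.map_add, Multiset.map_map, add_assoc]
      congr 2
      refine Multiset.map_congr rfl fun t ht => ?_
      have := lt_of_mem_weights ht
      simp only [Function.comp]
      omega
    · rw [weights_succ_of_notMem hA, weights_succ_of_mem (by simpa using hA), weights_univ_succ,
        ← ih, Multiset.map_add, Multiset.map_map, add_assoc]
      congr 1
      rw [add_comm]
      congr 1
      · refine Multiset.map_congr rfl fun t ht => ?_
        simp only [Function.comp]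
        omega
      · have hinj : Set.InjOn (fun x => 2 * v - x) (Finset.Ico 1 (v + 1) : Set ℕ) := by
          intro a ha b hb hab
          simp only [Finset.coe_Ico, Set.mem_Ico] at ha hb hab
          omega
        have := Finset.image_val_of_injOn hinj
        rw [show (Multiset.Ico 1 (v+1)) = (Finset.Ico 1 (v+1)).val from rfl,
          show 2 * (v + 1) - 2 = 2 * v by omega, ← this]
        have h2 : (Finset.Ico 1 (v + 1)).image (fun x => 2 * v - x) = Finset.Ico v (2 * v) := by
          ext x
          simp only [Finset.mem_image, Finset.mem_Ico]
          constructor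
          · rintro ⟨a, ha, rfl⟩
            omega
          · intro h
            exact ⟨2 * v - x, by omega, by omega⟩
        rw [h2]
        rfl

theorem weights_compl_congr {v : ℕ} {A B : Set ℕ} (h : weights v A = weights v B) :
    weights v Aᶜ = weights v Bᶜ := by
  have hA := weights_add_map_compl v A
  have hB := weights_add_map_compl v B
  rw [h, ← hB, add_right_inj] at hA
  have := congrArg (Multiset.map (2 * v - 2 - ·)) hA
  have key : ∀ C : Set ℕ, ((weights v C).map (2 * v - 2 - ·)).map (2 * v - 2 - ·) = weights v C := by
    intro C
    rw [Multiset.map_map]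
    conv_rhs => rw [← Multiset.map_id (weights v C)]
    refine Multiset.map_congr rfl fun t ht => ?_
    have := lt_of_mem_weights ht
    simp only [Function.comp, id]
    omega
  rwa [key, key] at this

theorem card_weights_univ (v : ℕ) : (weights v Set.univ).card = v.choose 2 := by
  induction v with
  | zero => simp
  | succ v ih =>
    rw [weights_univ_succ, Multiset.card_add, ih, card_multiset_Ico, Nat.choose_succ_succ' v 1,
      Nat.choose_one_right, one_add_one_eq_two]
    omega

theorem card_weights_add_card_compl (v : ℕ) (A : Set ℕ) :
    (weights v A).card + (weights v Aᶜ).card = v.choose 2 := by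
  rw [← card_weights_univ, ← weights_add_map_compl v A, Multiset.card_add, Multiset.card_map]

theorem sum_add_sum_map_sub (m : Multiset ℕ) (N : ℕ) (h : ∀ t ∈ m, t ≤ N) :
    m.sum + (m.map (N - ·)).sum = N * m.card := by
  induction m using Multiset.induction_on with
  | empty => simp
  | cons a m ih =>
    have := ih fun t ht => h t (Multiset.mem_cons_of_mem ht)
    have ha := h a (Multiset.mem_cons_self a m)
    simp only [Multiset.sum_cons, Multiset.map_cons, Multiset.card_cons, mul_add]
    omega

/-- `A` maximizes the sum of `weights v` among all sets with as many edges. Since the sum of the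
squared degrees is twice that sum, this is optimality among threshold graphs. -/
def MaximalWeight (v : ℕ) (A : Set ℕ) : Prop :=
  ∀ B : Set ℕ, (weights v B).card = (weights v A).card → (weights v B).sum ≤ (weights v A).sum

theorem MaximalWeight.compl {v : ℕ} {A : Set ℕ} (hA : MaximalWeight v A) :
    MaximalWeight v Aᶜ := by
  intro B hB
  have key : ∀ C : Set ℕ, (weights v C).sum + (2 * v - 2) * (weights v Cᶜ).card
      = (weights v Set.univ).sum + (weights v Cᶜ).sum := by
    intro C
    have h1 := sum_add_sum_map_sub (weights v Cᶜ) (2 * v - 2) fun t ht => by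
      have := lt_of_mem_weights ht
      omega
    have h2 := congrArg Multiset.sum (weights_add_map_compl v C)
    rw [Multiset.sum_add] at h2
    omega
  have c1 := card_weights_add_card_compl v A
  have c2 := card_weights_add_card_compl v B
  have := hA Bᶜ (by omega)
  have k1 := key A
  have k2 := key Bᶜ
  rw [compl_compl] at k2
  rw [hB] at k2
  omega

theorem MaximalWeight.of_succ {v : ℕ} {A : Set ℕ} (hA : MaximalWeight (v + 1) A) :
    MaximalWeight v A := by
  intro B hB
  by_cases hv : v ∈ A
  · have hB' : weights v (insert v B) = weights v B :=
      weights_congr fun x _ hx => by simp [hx.ne]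
    have := hA (insert v B)
    rw [weights_succ_of_mem hv, weights_succ_of_mem (Set.mem_insert v B), hB'] at this
    simp only [Multiset.card_add, Multiset.card_map, Multiset.sum_add, hB, Multiset.sum_map_add,
      Multiset.map_id', Multiset.map_const', Multiset.sum_replicate] at this
    simpa using this
  · have hB' : weights v (B \ {v}) = weights v B :=
      weights_congr fun x _ hx => by simp [hx.ne]
    have := hA (B \ {v})
    rw [weights_succ_of_notMem hv, weights_succ_of_notMem (by simp), hB'] at this
    exact this hB

/-! ### Quasi-complete graphs and the exchange of edges -/

/-- The partition `{1, …, c} \ {j}` of a quasi-complete graph. The number `j` is arbitrary here, and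
nothing is removed if it is `0` or exceeds `c`. -/
def stair (c j : ℕ) : Set ℕ := {x | 0 < x ∧ x ≤ c ∧ x ≠ j}

theorem mem_stair {c j x : ℕ} : x ∈ stair c j ↔ 0 < x ∧ x ≤ c ∧ x ≠ j := Iff.rfl

/-- With `j = c - i`, the quasi-complete graph consists of a complete graph on `c` vertices and a
column with `i` edges, at the positions `(0, c), …, (i - 1, c)`. -/
theorem weights_stair {c i v : ℕ} (hi : i ≤ c) (hv : c < v) :
    weights v (stair c (c - i)) = weights c Set.univ + Multiset.Ico c (c + i) := by
  rw [weights_eq_of_le (show c + 1 ≤ v from hv) fun x hx _ h => by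
    have := h.2.1
    omega]
  clear hv
  induction i generalizing c with
  | zero =>
    rw [weights_succ_of_notMem (by simp [stair])]
    simp only [add_zero, Multiset.Ico_self]
    refine weights_congr fun x h0 hx => ?_
    simp [stair]
    omega
  | succ i ih =>
    obtain ⟨c, rfl⟩ : ∃ d, c = d + 1 := ⟨c - 1, by omega⟩
    have hc : c + 1 ∈ stair (c + 1) (c + 1 - (i + 1)) := ⟨by omega, le_rfl, by omega⟩
    have hw : weights (c + 1) (stair (c + 1) (c + 1 - (i + 1)))
        = weights (c + 1) (stair c (c - i)) :=
      weights_congr fun x h0 hx => by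
        simp only [mem_stair]
        omega
    rw [weights_succ_of_mem hc, hw, ih (by omega), weights_succ_of_mem (Set.mem_univ c),
      Multiset.map_add, Multiset.map_add_right_Ico,
      ← Multiset.Ico_add_Ico_eq_Ico (show 1 ≤ c + 1 by omega) (show c + 1 ≤ c + 1 + 1 by omega),
      ← Multiset.Ico_add_Ico_eq_Ico (show c + 1 ≤ c + 1 + 1 by omega)
      (show c + 1 + 1 ≤ c + 1 + (i + 1) by omega)]
    rw [show c + 1 + (i + 1) = c + i + 2 by ring]
    abel

/-- The weights after a part `x > c` is put in front of `{1, …, c} \ {c - i}`: the complete graph on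
the vertices `0, …, c`, the end of row `0` in the columns `c + 1, …, x`, and `i` positions
`(1, c + 1), …, (i, c + 1)` in the column `c + 1`. -/
theorem weights_insert_stair {x c i v : ℕ} (hi : i ≤ c) (hx : c < x) (hv : x < v) :
    weights v (insert x (stair c (c - i))) = weights (c + 1) Set.univ
      + Multiset.Ico (c + 1) (x + 1) + Multiset.Ico (c + 2) (c + 2 + i) := by
  rw [weights_eq_of_le (show x + 1 ≤ v from hv) fun y hy _ h => by
    simp only [Set.mem_insert_iff, mem_stair] at h
    omega]
  have hw : weights x (insert x (stair c (c - i))) = weights x (stair c (c - i)) :=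
    weights_congr fun y h0 hy => by simp [hy.ne]
  rw [weights_succ_of_mem (Set.mem_insert _ _), hw, weights_stair hi hx,
    weights_succ_of_mem (Set.mem_univ c), Multiset.map_add, Multiset.map_add_right_Ico,
    ← Multiset.Ico_add_Ico_eq_Ico (show 1 ≤ c + 1 by omega) (show c + 1 ≤ x + 1 by omega),
    show c + i + 2 = c + 2 + i by ring]
  abel

/-- A graph of maximal weight which is a dominating vertex added to a quasi-complete graph is
quasi-complete up to the order of its weights, or else has many more vertices than the
quasi-complete part: otherwise edges can be moved with profit from the end of the first row to the
incomplete column. -/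
theorem MaximalWeight.stair_or_le {n c i : ℕ} {A : Set ℕ} (hA : MaximalWeight (n + 1) A)
    (hi : i < c) (hc : c + 2 ≤ n)
    (hw : weights (n + 1) A = weights (n + 1) (insert n (stair c (c - i)))) :
    (∃ i' ≤ c + 1, weights (n + 1) A = weights (n + 1) (stair (c + 1) (c + 1 - i'))) ∨
      2 * c + 1 ≤ n := by
  have hw' := hw
  rw [weights_insert_stair hi.le (by omega) (by omega)] at hw
  obtain ⟨m, hm0, hmi, hmn, hm⟩ : ∃ m, 0 < m ∧ i + m ≤ c ∧ c + 1 + m ≤ n ∧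
      (i + m = c ∨ c + 1 + m = n) :=
    -- as many edges as fit into the column, or as the row has beyond it
    ⟨min (c - i) (n - c - 1), by omega, by omega, by omega, by omega⟩
  have hcmp := hA (insert (n - m) (stair c (c - (i + m))))
  have hle : c + 1 + i + m ≤ n := by
    rw [hw, weights_insert_stair hmi (by omega) (by omega)] at hcmp
    simp only [Multiset.card_add, Multiset.sum_add, card_multiset_Ico] at hcmp
    have hcmp := hcmp (by omega)
    have e1 := two_mul_sum_Ico_add (c + 1) (n + 1) (by omega)
    have e2 := two_mul_sum_Ico_add (c + 1) (n - m + 1) (by omega)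
    have e3 := two_mul_sum_Ico_add (c + 2) (c + 2 + i) (by omega)
    have e4 := two_mul_sum_Ico_add (c + 2) (c + 2 + (i + m)) (by omega)
    obtain ⟨p, rfl⟩ := Nat.exists_eq_add_of_le (show m ≤ n by omega)
    rw [Nat.add_sub_cancel_left] at e2 hcmp
    by_contra! hlt
    have : m * (m + p) < m * (c + 1 + i + m) := Nat.mul_lt_mul_of_pos_left hlt hm0
    nlinarith
  rcases hm with hm | hm
  · right
    omega
  · left
    obtain rfl : i = 0 := by omega
    refine ⟨m + 1, by omega, ?_⟩
    have h1 := weights_stair (c := c + 1) (i := m + 1) (v := n + 1) (by omega) (by omega)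
    rw [hw, h1, show c + 1 + (m + 1) = n + 1 by omega]
    simp

/-- With `2 * c + 1 ≤ n` vertices or more, a quasi-complete graph on `c + 1 ≥ 4` non-isolated
vertices is not of maximal weight: its last two columns yield to a longer first row. -/
theorem MaximalWeight.lt_three {n c i : ℕ} {A : Set ℕ} (hA : MaximalWeight n A)
    (hi : 0 < i) (hic : i ≤ c) (hc : 2 * c + 1 ≤ n)
    (hw : weights n A = weights n (stair c (c - i))) : c < 3 := by
  by_contra! h3
  obtain ⟨d, rfl⟩ : ∃ d, c = d + 2 := ⟨c - 2, by omega⟩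
  rw [weights_stair hic (by omega), weights_univ_succ] at hw
  -- The two columns of the original correspond to `x + 1 = 2 * d + 2`, `y = i`. For fixed `x + y`
  -- the weight is a convex quadratic polynomial in `x`, with the same value at
  -- `x + 1 = d + 2 + i`, so that it is larger when `x + 1` exceeds both these numbers.
  obtain ⟨x, y, hxy, hy, hx1, hx2, hxn⟩ : ∃ x y, x + 1 + y = 2 * d + 2 + i ∧ y ≤ d ∧
      2 * d + 2 < x + 1 ∧ d + 2 + i < x + 1 ∧ x < n :=
    ⟨min (2 * d + 2 + i) n - 1, 2 * d + 2 + i - min (2 * d + 2 + i) n, by omega, by omega,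
      by omega, by omega, by omega⟩
  have hcmp := hA (insert x (stair d (d - y)))
  rw [hw, weights_insert_stair hy (by omega) hxn] at hcmp
  simp only [Multiset.card_add, Multiset.sum_add, card_multiset_Ico] at hcmp
  have hcmp := hcmp (by omega)
  have e1 := two_mul_sum_Ico_add (d + 1) (x + 1) (by omega)
  have e2 := two_mul_sum_Ico_add (d + 2) (d + 2 + y) (by omega)
  have e3 := two_mul_sum_Ico_add (d + 1) (2 * (d + 1)) (by omega)
  have e4 := two_mul_sum_Ico_add (d + 2) (d + 2 + i) (by omega)
  obtain ⟨a, ha⟩ := Nat.exists_eq_add_of_lt hx1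
  obtain ⟨b, hb⟩ := Nat.exists_eq_add_of_lt hx2
  obtain rfl : x = 2 * d + 2 + a := by omega
  obtain rfl : i = y + a + 1 := by omega
  obtain rfl : d = y + 1 + b := by omega
  have hpos : 0 < (a + 1) * (b + 1) := by positivity
  linarith

/-- The small quasi-complete graphs (no edge, one edge, a path with two edges, and a triangle) have
the weights of a star. `Multiset.Ico 1 (f + 1)` are the weights of the star with `f` edges. -/
theorem exists_weights_eq_Ico {n c i : ℕ} {A : Set ℕ} (hi : i ≤ c) (hc : 2 * c + 1 ≤ n)
    (h : c < 3 ∨ c = 3 ∧ i = 0) (hw : weights n A = weights n (stair c (c - i))) :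
    ∃ f < n, weights n A = Multiset.Ico 1 (f + 1) := by
  rw [weights_stair hi (by omega)] at hw
  have h1 : weights 2 Set.univ = Multiset.Ico 1 2 := by rw [weights_univ_succ]; simp
  have h2 : weights 3 Set.univ = Multiset.Ico 1 4 := by rw [weights_univ_succ, h1]; rfl
  obtain hc3 : c ≤ 3 := by omega
  interval_cases c
  · exact ⟨0, by omega, by simpa [show i = 0 by omega] using hw⟩
  · rw [weights_one, zero_add] at hw
    exact ⟨i, by omega, by rw [hw, add_comm]⟩
  · rw [h1, Multiset.Ico_add_Ico_eq_Ico (by omega) (by omega)] at hw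
    exact ⟨i + 1, by omega, by rw [hw]; congr 1; omega⟩
  · exact ⟨3, by omega, by simpa [show i = 0 by omega, h2] using hw⟩

/-- A graph of maximal weight which is a dominating vertex added to a quasi-complete graph has the
weights of a quasi-complete graph, unless it has those of a dominating vertex added to a star. -/
theorem MaximalWeight.of_mem {n c i : ℕ} {A : Set ℕ} (hA : MaximalWeight (n + 1) A)
    (hn : n ∈ A) (hi : i ≤ c) (hc : c < n) (hw : weights n A = weights n (stair c (c - i))) :
    (∃ c' i', i' ≤ c' ∧ c' ≤ n ∧ weights (n + 1) A = weights (n + 1) (stair c' (c' - i'))) ∨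
      ∃ f < n, weights n A = Multiset.Ico 1 (f + 1) := by
  have hins : ∀ {c j : ℕ}, weights n A = weights n (stair c j) →
      weights (n + 1) A = weights (n + 1) (insert n (stair c j)) := by
    intro c j h
    rw [weights_succ_of_mem hn, weights_succ_of_mem (Set.mem_insert _ _), h]
    congr 2
    exact weights_congr fun x _ hx => by simp [hx.ne]
  have hw1 := hins hw
  rcases hi.lt_or_eq with hi | rfl
  · rcases (show c + 1 ≤ n from hc).eq_or_lt with rfl | hc2
    · left
      refine ⟨c + 1, i + 1, by omega, le_rfl, hw1.trans (weights_congr fun x h0 hx => ?_)⟩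
      simp only [Set.mem_insert_iff, mem_stair]
      omega
    rcases hA.stair_or_le hi hc2 hw1 with ⟨i', hi', h⟩ | h
    · exact Or.inl ⟨c + 1, i', hi', by omega, h⟩
    · right
      rcases Nat.eq_zero_or_pos i with rfl | hi0
      · -- an empty column: `{1, …, c + 1} \ {c + 1}` is regarded as `{1, …, c}`
        obtain ⟨c, rfl⟩ : ∃ d, c = d + 1 := ⟨c - 1, by omega⟩
        have hw2 : weights n A = weights n (stair c (c - c)) := by
          refine hw.trans (weights_congr fun x h0 hx => ?_)
          simp only [mem_stair]
          omega
        rcases Nat.eq_zero_or_pos c with rfl | hc0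
        · exact exists_weights_eq_Ico le_rfl (by omega) (by omega) hw2
        have := hA.of_succ.lt_three hc0 le_rfl (by omega) hw2
        exact exists_weights_eq_Ico hi.le h (by omega) hw
      · have := hA.of_succ.lt_three hi0 hi.le h hw
        exact exists_weights_eq_Ico hi.le h (by omega) hw
  · -- a full column: `{1, …, i}` is regarded as `{1, …, i + 1} \ {i + 1}`, with an empty column
    have hw2 : weights n A = weights n (stair (i + 1) (i + 1 - 0)) := by
      refine hw.trans (weights_congr fun x h0 hx => ?_)
      simp only [mem_stair]
      omega
    rcases (show i + 1 ≤ n from hc).eq_or_lt with rfl | hc2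
    · left
      refine ⟨i + 1, i + 1, by omega, le_rfl, hw1.trans (weights_congr fun x h0 hx => ?_)⟩
      simp only [Set.mem_insert_iff, mem_stair]
      omega
    rcases (show i + 2 ≤ n from hc2).eq_or_lt with rfl | hc3
    · left
      refine ⟨i + 2, 1, by omega, le_rfl, hw1.trans (weights_congr fun x h0 hx => ?_)⟩
      simp only [Set.mem_insert_iff, mem_stair]
      omega
    rcases hA.stair_or_le (by omega) (by omega) (hins hw2) with ⟨i', hi', h⟩ | h
    · exact Or.inl ⟨i + 1 + 1, i', hi', by omega, h⟩
    · right
      rcases Nat.eq_zero_or_pos i with rfl | hi0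
      · exact exists_weights_eq_Ico le_rfl (by omega) (by omega) hw
      · have := hA.of_succ.lt_three hi0 le_rfl (by omega) hw
        exact exists_weights_eq_Ico le_rfl (by omega) (by omega) hw

/-- The weights of a graph of maximal weight are those of a quasi-complete graph or of the
complement of one. -/
theorem MaximalWeight.exists_stair {v : ℕ} {A : Set ℕ} (hA : MaximalWeight v A) :
    ∃ c i, i ≤ c ∧ c ≤ v - 1 ∧ (weights v A = weights v (stair c (c - i)) ∨
      weights v A = weights v (stair c (c - i))ᶜ) := by
  induction v generalizing A with
  | zero => exact ⟨0, 0, le_rfl, le_rfl, Or.inl rfl⟩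
  | succ n ih =>
    rcases Nat.eq_zero_or_pos n with rfl | hn0
    · exact ⟨0, 0, le_rfl, le_rfl, Or.inl (by simp)⟩
    -- complementation exchanges the two alternatives, so `n` may be taken to lie in `A`
    wlog hn : n ∈ A generalizing A
    · obtain ⟨c, i, hi, hc, h⟩ := this hA.compl hn
      refine ⟨c, i, hi, hc, h.symm.imp (fun h => ?_) (fun h => ?_)⟩
      · simpa using weights_compl_congr h
      · simpa using weights_compl_congr h
    obtain ⟨c, i, hi, hc, h | h⟩ := ih hA.of_succ
    · rcases hA.of_mem hn hi (by omega) h with ⟨c', i', hi', hc', h'⟩ | ⟨f, hf, h'⟩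
      · exact ⟨c', i', hi', by omega, Or.inl h'⟩
      · -- a dominating vertex and a star: the parts `n` and `f`, which are the complement of
        -- `{1, …, n - 1} \ {f}`
        refine ⟨n - 1, n - 1 - f, by omega, by omega, Or.inr ?_⟩
        have hmem : n ∈ (stair (n - 1) (n - 1 - (n - 1 - f)))ᶜ := fun h => by
          have := h.2.1
          omega
        rw [weights_succ_of_mem hn, weights_succ_of_mem hmem, h']
        congr 2
        have h1 : weights n (stair (n - 1) (n - 1 - (n - 1 - f)))ᶜ = weights n {f} :=
          weights_congr fun x h0 hx => by
            simp only [Set.mem_compl_iff, mem_stair, Set.mem_singleton_iff]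
            omega
        rw [h1, weights_eq_of_le (show f + 1 ≤ n from hf) fun x hx _ h => by
          rw [Set.mem_singleton_iff] at h
          omega, weights_succ_of_mem (Set.mem_singleton f)]
        have h2 : weights f {f} = weights 0 {f} := weights_eq_of_le (Nat.zero_le f)
          fun x _ hx h => hx.ne h
        simp [h2]
    · refine ⟨c, i, hi, by omega, Or.inr ?_⟩
      have hmem : n ∈ (stair c (c - i))ᶜ := fun h => by
        have := h.2.1
        omega
      rw [weights_succ_of_mem hn, weights_succ_of_mem hmem, h]

/-! ### Threshold graphs built vertex by vertex -/

/-- The graph obtained by adding the vertices `0, …, v - 1` one after the other, a vertex of `A` being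
joined to all earlier vertices and any other vertex to none of them. This is the threshold graph of
the partition into the positive elements of `A` below `v`, with the vertices in another order, in
which the passage to the complement is the passage to the complement of `A`. -/
def buildGraph (v : ℕ) (A : Set ℕ) : SimpleGraph (Fin v) where
  Adj i j := i ≠ j ∧ max (i : ℕ) j ∈ A
  symm := ⟨fun i j h => ⟨h.1.symm, max_comm (i : ℕ) j ▸ h.2⟩⟩
  loopless := ⟨fun _ h => h.1 rfl⟩

theorem buildGraph_adj {v : ℕ} {A : Set ℕ} {i j : Fin v} :
    (buildGraph v A).Adj i j ↔ i ≠ j ∧ max (i : ℕ) j ∈ A := Iff.rfl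

theorem buildGraph_compl (v : ℕ) (A : Set ℕ) : (buildGraph v A)ᶜ = buildGraph v Aᶜ := by
  ext i j
  simp only [SimpleGraph.compl_adj, buildGraph_adj, Set.mem_compl_iff]
  tauto

open scoped Classical in
theorem degree_buildGraph_castSucc (v : ℕ) (A : Set ℕ) (i : Fin v) :
    (buildGraph (v + 1) A).degree i.castSucc
      = (buildGraph v A).degree i + if v ∈ A then 1 else 0 := by
  simp only [← SimpleGraph.card_neighborFinset_eq_degree, SimpleGraph.neighborFinset_eq_filter,
    Finset.card_filter, Fin.sum_univ_castSucc, buildGraph_adj]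
  congr 1
  · refine Finset.sum_congr rfl fun j _ => ?_
    simp [Fin.ext_iff]
  · have h : i.castSucc ≠ Fin.last v := (Fin.castSucc_lt_last i).ne
    simp [h]

open scoped Classical in
theorem degree_buildGraph_last (v : ℕ) (A : Set ℕ) :
    (buildGraph (v + 1) A).degree (Fin.last v) = if v ∈ A then v else 0 := by
  simp only [← SimpleGraph.card_neighborFinset_eq_degree, SimpleGraph.neighborFinset_eq_filter,
    Finset.card_filter, Fin.sum_univ_castSucc, buildGraph_adj]
  have h : ∀ i : Fin v, Fin.last v ≠ i.castSucc := fun i => (Fin.castSucc_lt_last i).ne'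
  by_cases hv : v ∈ A <;> simp [h, hv]

open scoped Classical in
theorem sum_degree_buildGraph (v : ℕ) (A : Set ℕ) :
    ∑ i, (buildGraph v A).degree i = 2 * (weights v A).card := by
  induction v with
  | zero => simp
  | succ v ih =>
    rw [Fin.sum_univ_castSucc, degree_buildGraph_last]
    simp only [degree_buildGraph_castSucc, Finset.sum_add_distrib, ih]
    by_cases hv : v ∈ A
    · simp only [hv, if_true, weights_succ_of_mem hv, Multiset.card_add, Multiset.card_map,
        card_multiset_Ico, Finset.sum_const, Finset.card_univ, Fintype.card_fin, smul_eq_mul]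
      omega
    · simp [hv, weights_succ_of_notMem hv]

theorem sumSqDegrees_buildGraph (v : ℕ) (A : Set ℕ) :
    sumSqDegrees (buildGraph v A) = 2 * (weights v A).sum := by
  classical
  unfold sumSqDegrees
  induction v with
  | zero => simp
  | succ v ih =>
    have hd := sum_degree_buildGraph v A
    rw [Fin.sum_univ_castSucc]
    by_cases hv : v ∈ A
    · have e := two_mul_sum_Ico_add 1 (v + 1) (by omega)
      have hs : ((weights v A).map (· + 2)).sum = (weights v A).sum + (weights v A).card * 2 := by
        simp [Multiset.sum_map_add]
      have h1 : ∀ i : Fin v, (buildGraph (v + 1) A).degree i.castSucc ^ 2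
          = (buildGraph v A).degree i ^ 2 + (2 * (buildGraph v A).degree i + 1) := fun i => by
        rw [degree_buildGraph_castSucc, if_pos hv]
        ring
      have h2 := degree_buildGraph_last v A
      rw [if_pos hv] at h2
      rw [Finset.sum_congr rfl fun i _ => h1 i, h2, Finset.sum_add_distrib, ih,
        Finset.sum_add_distrib, ← Finset.mul_sum, hd, weights_succ_of_mem hv, Multiset.sum_add, hs]
      simp only [Finset.sum_const, Finset.card_univ, Fintype.card_fin, smul_eq_mul]
      nlinarith
    · have h1 : ∀ i : Fin v, (buildGraph (v + 1) A).degree i.castSucc ^ 2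
          = (buildGraph v A).degree i ^ 2 := fun i => by
        rw [degree_buildGraph_castSucc, if_neg hv, add_zero]
      have h2 := degree_buildGraph_last v A
      rw [if_neg hv] at h2
      rw [Finset.sum_congr rfl fun i _ => h1 i, h2, ih, weights_succ_of_notMem hv]
      rfl

open scoped Classical in
theorem sum_degree_eq_two_mul_ncard {v : ℕ} (G : SimpleGraph (Fin v)) :
    ∑ i, G.degree i = 2 * G.edgeSet.ncard := by
  rw [SimpleGraph.sum_degrees_eq_twice_card_edges, ← SimpleGraph.coe_edgeFinset,
    Set.ncard_coe_finset]

theorem ncard_edgeSet_buildGraph (v : ℕ) (A : Set ℕ) :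
    (buildGraph v A).edgeSet.ncard = (weights v A).card := by
  classical
  have h1 := sum_degree_buildGraph v A
  have h2 := sum_degree_eq_two_mul_ncard (buildGraph v A)
  omega

theorem sumSqDegrees_congr {v : ℕ} {G H : SimpleGraph (Fin v)} (f : G ≃g H) :
    sumSqDegrees G = sumSqDegrees H := by
  classical
  unfold sumSqDegrees
  refine Fintype.sum_equiv f.toEquiv _ _ fun i => ?_
  rw [← SimpleGraph.Iso.degree_eq f i]
  rfl

theorem ncard_edgeSet_congr {v : ℕ} {G H : SimpleGraph (Fin v)} (f : G ≃g H) :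
    G.edgeSet.ncard = H.edgeSet.ncard :=
  Set.ncard_congr' f.mapEdgeSet

theorem IsOptimal.maximalWeight {v e : ℕ} {G : SimpleGraph (Fin v)} (hG : IsOptimal v e G)
    {A : Set ℕ} (f : G ≃g buildGraph v A) : MaximalWeight v A := by
  intro B hB
  have h := hG.2 (buildGraph v B) (by
    have h1 : G.edgeSet.ncard = e := hG.1
    change (buildGraph v B).edgeSet.ncard = e
    rw [ncard_edgeSet_buildGraph, hB, ← ncard_edgeSet_buildGraph, ← ncard_edgeSet_congr f, h1])
  rw [sumSqDegrees_congr f, sumSqDegrees_buildGraph, sumSqDegrees_buildGraph] at h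
  omega

/-- An isomorphism extends to graphs with one more vertex, here `none`, when this vertex is isolated in
both or dominating in both. -/
theorem nonempty_iso_of_option {V W V' W' : Type*} {G : SimpleGraph V} {H : SimpleGraph W}
    {G' : SimpleGraph V'} {H' : SimpleGraph W'} (a : Option V' ≃ V) (b : Option W' ≃ W)
    (f : G' ≃g H') (hG : ∀ x y, G.Adj (a (some x)) (a (some y)) ↔ G'.Adj x y)
    (hH : ∀ x y, H.Adj (b (some x)) (b (some y)) ↔ H'.Adj x y) (p : Prop)
    (hp : ∀ x, G.Adj (a none) (a (some x)) ↔ p) (hq : ∀ x, H.Adj (b none) (b (some x)) ↔ p) :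
    Nonempty (G ≃g H) := by
  refine ⟨⟨a.symm.trans ((Equiv.optionCongr f.toEquiv).trans b), ?_⟩⟩
  intro x y
  obtain ⟨x, rfl⟩ := a.surjective x
  obtain ⟨y, rfl⟩ := a.surjective y
  have hp' : ∀ x, G.Adj (a (some x)) (a none) ↔ p := fun x => by rw [G.adj_comm, hp]
  have hq' : ∀ x, H.Adj (b (some x)) (b none) ↔ p := fun x => by rw [H.adj_comm, hq]
  rcases x with _ | x <;> rcases y with _ | y <;> simp [hG, hH, hp, hq, hp', hq']
  exact f.map_rel_iff

/-! ### Optimal graphs are threshold graphs -/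

/-- For any two vertices, the neighbours of one of them are neighbours of the other, the two vertices
themselves apart. This characterizes threshold graphs. -/
def NestedNeighbors {V : Type*} (G : SimpleGraph V) : Prop :=
  ∀ x y a b, G.Adj x a → a ≠ y → ¬ G.Adj y a → G.Adj y b → b ≠ x → G.Adj x b

theorem NestedNeighbors.adj_of_degree_le {V : Type*} [Fintype V] {G : SimpleGraph V}
    [DecidableRel G.Adj] (hG : NestedNeighbors G) {x y b : V} (h : G.degree y ≤ G.degree x)
    (hb : G.Adj y b) (hbx : b ≠ x) : G.Adj x b := by
  classical
  by_contra hxb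
  have hsub : (G.neighborFinset x).erase y ⊂ (G.neighborFinset y).erase x := by
    refine (Finset.ssubset_iff_of_subset fun a ha => ?_).2 ⟨b, by simp [hb, hbx], by simp [hxb]⟩
    simp only [Finset.mem_erase, SimpleGraph.mem_neighborFinset] at ha ⊢
    refine ⟨ha.2.ne', ?_⟩
    by_contra hya
    exact hxb (hG x y a b ha.2 ha.1 hya hb hbx)
  have hcard := Finset.card_lt_card hsub
  rw [← SimpleGraph.card_neighborFinset_eq_degree, ← SimpleGraph.card_neighborFinset_eq_degree] at h
  by_cases hxy : G.Adj x y
  · rw [Finset.card_erase_of_mem (by simpa using hxy),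
      Finset.card_erase_of_mem (by simpa using hxy.symm)] at hcard
    omega
  · rw [Finset.erase_eq_of_notMem (by simpa using hxy),
      Finset.erase_eq_of_notMem (by simpa [G.adj_comm] using hxy)] at hcard
    omega

theorem NestedNeighbors.exists_isolated_or_dominating {V : Type*} [Finite V] [Nonempty V]
    {G : SimpleGraph V} (hG : NestedNeighbors G) :
    ∃ w, ∃ p : Prop, ∀ x, x ≠ w → (G.Adj w x ↔ p) := by
  classical
  have := Fintype.ofFinite V
  obtain ⟨u, hu⟩ := Finite.exists_max (fun x => G.degree x)
  obtain ⟨w, hw⟩ := Finite.exists_min (fun x => G.degree x)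
  by_cases h : ∃ x, G.Adj w x
  · obtain ⟨x, hx⟩ := h
    have huw : u = w ∨ G.Adj u w := by
      by_cases hxu : x = u
      · exact Or.inr (hxu ▸ hx.symm)
      by_cases huw : u = w
      · exact Or.inl huw
      · exact Or.inr (hG.adj_of_degree_le (hu x) hx.symm (Ne.symm huw))
    refine ⟨u, True, fun y hy => iff_true_intro ?_⟩
    rcases huw with rfl | huw
    · -- `u` has the largest and the smallest degree, so all degrees agree
      by_cases hyx : y = x
      · exact hyx ▸ hx
      · have hxy := hG.adj_of_degree_le (hw y) hx (Ne.symm hyx)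
        exact hG.adj_of_degree_le (hu x) hxy.symm hy
    · by_cases hyw : y = w
      · exact hyw ▸ huw
      · exact (hG.adj_of_degree_le (hw y) huw.symm hy.symm).symm
  · exact ⟨w, False, fun x _ => iff_false_intro fun hx => h ⟨x, hx⟩⟩

theorem NestedNeighbors.exists_iso_buildGraph {n : ℕ} {V : Type*} [Finite V] {G : SimpleGraph V}
    (hV : Nat.card V = n) (hG : NestedNeighbors G) :
    ∃ A : Set ℕ, Nonempty (G ≃g buildGraph n A) := by
  classical
  induction n generalizing V with
  | zero =>
    have : IsEmpty V := (Finite.card_eq_zero_iff).1 hV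
    exact ⟨∅, ⟨⟨Equiv.equivOfIsEmpty _ _, fun {x} => isEmptyElim x⟩⟩⟩
  | succ n ih =>
    have : Nonempty V := (Nat.card_pos_iff.1 (by omega)).1
    obtain ⟨w, p, hw⟩ := hG.exists_isolated_or_dominating
    let G' : SimpleGraph {x // x ≠ w} := G.comap Subtype.val
    have hcard : Nat.card {x // x ≠ w} = n := by
      have := Nat.card_congr (Equiv.optionSubtypeNe w)
      rw [Finite.card_option] at this
      omega
    obtain ⟨A, ⟨f⟩⟩ := ih (G := G') hcard fun x y a b h1 h2 h3 h4 h5 =>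
      hG x y a b h1 (fun h => h2 (Subtype.ext h)) h3 h4 (fun h => h5 (Subtype.ext h))
    refine ⟨{x | x < n ∧ x ∈ A ∨ x = n ∧ p}, nonempty_iso_of_option (Equiv.optionSubtypeNe w)
      finSuccEquivLast.symm f (fun x y => by simp [G']) (fun x y => ?_) p
      (fun x => by simpa using hw x x.2) fun x => ?_⟩
    · have h : max (x : ℕ) y < n := max_lt x.isLt y.isLt
      simp only [finSuccEquivLast_symm_some, buildGraph_adj, Set.mem_ofPred_eq,
        Fin.val_castSucc, h, h.ne, ne_eq, Fin.castSucc_inj]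
      simp
    · have h : Fin.last n ≠ x.castSucc := (Fin.castSucc_lt_last x).ne'
      simp only [finSuccEquivLast_symm_some, finSuccEquivLast_symm_none, buildGraph_adj,
        Set.mem_ofPred_eq, Fin.val_castSucc, Fin.val_last, max_eq_left x.isLt.le]
      simp [h]

open scoped Classical in
/-- If `x` has at least the degree of `y`, replacing an edge `y b` by `x b` would increase the sum of
the squares of the degrees. -/
theorem IsOptimal.adj_of_degree_le {v e : ℕ} {G : SimpleGraph (Fin v)} (hG : IsOptimal v e G)
    {x y b : Fin v} (h : G.degree y ≤ G.degree x) (hb : G.Adj y b) (hbx : b ≠ x) :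
    G.Adj x b := by
  by_contra hxb
  have hyb : y ≠ b := hb.ne
  have hxy : x ≠ y := fun h => hxb (h ▸ hb)
  -- `H` arises from `G` by replacing the edge `y b` by the edge `x b`
  obtain ⟨H, hH⟩ : ∃ H : SimpleGraph (Fin v), ∀ i j, H.Adj i j ↔
      (G.Adj i j ∧ ¬ (i = y ∧ j = b) ∧ ¬ (i = b ∧ j = y)) ∨
        (i = x ∧ j = b) ∨ (i = b ∧ j = x) := by
    refine ⟨SimpleGraph.fromRel fun i j =>
      (G.Adj i j ∧ s(i, j) ≠ s(y, b)) ∨ (i = x ∧ j = b), fun i j => ?_⟩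
    simp only [SimpleGraph.fromRel_adj, ne_eq, Sym2.eq_iff, G.adj_comm j i]
    have := @SimpleGraph.Adj.ne _ G i j
    constructor
    · tauto
    · rintro (h | ⟨rfl, rfl⟩ | ⟨rfl, rfl⟩)
      · exact ⟨this h.1, by tauto⟩
      · exact ⟨hbx.symm, by tauto⟩
      · exact ⟨hbx, by tauto⟩
  -- the adjacency matrix changes in four entries; in row `b` the changes cancel
  have hterm : ∀ i j, (if H.Adj i j then (1 : ℤ) else 0) = (if G.Adj i j then 1 else 0)
      + ((if i = x then 1 else 0) - (if i = y then 1 else 0)) * (if j = b then 1 else 0)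
      + (if i = b then 1 else 0) * ((if j = x then 1 else 0) - (if j = y then 1 else 0)) := by
    intro i j
    rw [if_congr (hH i j) rfl rfl]
    have hbx' : ¬ G.Adj b x := fun h => hxb h.symm
    have hby : G.Adj b y := hb.symm
    by_cases h1 : i = x
    · subst h1
      by_cases h2 : j = b
      · subst h2; simp [*, Ne.symm hbx]
      · simp [*, Ne.symm hbx]
    by_cases h2 : i = y
    · subst h2
      by_cases h3 : j = b
      · subst h3; simp [*]
      · simp [*]
    by_cases h3 : i = b
    · subst h3
      by_cases h4 : j = x
      · subst h4; simp [*]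
      by_cases h5 : j = y
      · subst h5; simp [*]
      · simp [*]
    · simp [*]
  have hdeg : ∀ K : SimpleGraph (Fin v), ∀ i,
      ((K.degree i : ℕ) : ℤ) = ∑ j, if K.Adj i j then (1 : ℤ) else 0 := by
    intro K i
    rw [← SimpleGraph.card_neighborFinset_eq_degree, SimpleGraph.neighborFinset_eq_filter,
      Finset.card_filter]
    push_cast
    rfl
  have hdegH : ∀ i, ((H.degree i : ℕ) : ℤ) = G.degree i
      + ((if i = x then 1 else 0) - (if i = y then 1 else 0)) := by
    intro i
    rw [hdeg, hdeg, Finset.sum_congr rfl fun j _ => hterm i j]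
    simp [Finset.sum_add_distrib]
  have hsum : ∑ i, ((H.degree i : ℕ) : ℤ) = ∑ i, ((G.degree i : ℕ) : ℤ) := by
    simp [hdegH, Finset.sum_add_distrib]
  have hsq : ∑ i, ((H.degree i : ℕ) : ℤ) ^ 2 = ∑ i, ((G.degree i : ℕ) : ℤ) ^ 2
      + (2 * (G.degree x - G.degree y) + 2) := by
    have : ∀ i, ((H.degree i : ℕ) : ℤ) ^ 2 = (G.degree i : ℤ) ^ 2
        + ((if i = x then (2 * G.degree i + 1 : ℤ) else 0)
          + (if i = y then (1 - 2 * G.degree i : ℤ) else 0)) := by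
      intro i
      rw [hdegH]
      by_cases h1 : i = x
      · subst h1; simp [hxy]; ring
      by_cases h2 : i = y
      · subst h2; simp [h1]; ring
      · simp [h1, h2]
    rw [Finset.sum_congr rfl fun i _ => this i]
    simp only [Finset.sum_add_distrib, Finset.sum_ite_eq', Finset.mem_univ, if_true]
    ring
  have hle := hG.2 H (by
    have h1 := sum_degree_eq_two_mul_ncard H
    have h2 := sum_degree_eq_two_mul_ncard G
    have h3 : G.edgeSet.ncard = e := hG.1
    change H.edgeSet.ncard = e
    norm_cast at hsum
    omega)
  unfold sumSqDegrees at hle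
  zify at hle h
  linarith

theorem IsOptimal.nestedNeighbors {v e : ℕ} {G : SimpleGraph (Fin v)} (hG : IsOptimal v e G) :
    NestedNeighbors G := by
  classical
  intro x y a b hxa hay hya hyb hbx
  rcases le_total (G.degree y) (G.degree x) with h | h
  · exact hG.adj_of_degree_le h hyb hbx
  · exact absurd (hG.adj_of_degree_le h hxa hay) hya

/-! ### Partitions into distinct parts and diagonal sequences -/

open scoped Classical in
/-- The positive elements of `A` below `v`, in decreasing order. -/
noncomputable def parts : ℕ → Set ℕ → List ℕ
  | 0, _ => []
  | v + 1, A => if v ∈ A ∧ v ≠ 0 then v :: parts v A else parts v A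

theorem parts_succ_of_mem {v : ℕ} {A : Set ℕ} (h : v ∈ A) (hv : v ≠ 0) :
    parts (v + 1) A = v :: parts v A := by
  simp [parts, h, hv]

theorem parts_succ_of_notMem {v : ℕ} {A : Set ℕ} (h : ¬ (v ∈ A ∧ v ≠ 0)) :
    parts (v + 1) A = parts v A := by
  rw [parts, if_neg h]

theorem mem_parts_bounds {v a : ℕ} {A : Set ℕ} (h : a ∈ parts v A) : 0 < a ∧ a < v := by
  induction v with
  | zero => simp [parts] at h
  | succ v ih =>
    by_cases hv : v ∈ A ∧ v ≠ 0
    · rw [parts_succ_of_mem hv.1 hv.2, List.mem_cons] at h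
      rcases h with rfl | h
      · omega
      · have := ih h
        omega
    · rw [parts_succ_of_notMem hv] at h
      have := ih h
      omega

theorem pairwise_parts (v : ℕ) (A : Set ℕ) : (parts v A).Pairwise fun a b => b < a := by
  induction v with
  | zero => simp [parts]
  | succ v ih =>
    by_cases hv : v ∈ A ∧ v ≠ 0
    · rw [parts_succ_of_mem hv.1 hv.2, List.pairwise_cons]
      exact ⟨fun a ha => (mem_parts_bounds ha).2, ih⟩
    · rwa [parts_succ_of_notMem hv]

theorem weights_succ_of_not_and {v : ℕ} {A : Set ℕ} (h : ¬ (v ∈ A ∧ v ≠ 0)) :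
    weights (v + 1) A = weights v A := by
  rcases Nat.eq_zero_or_pos v with rfl | hv
  · simp
  · exact weights_succ_of_notMem fun h1 => h ⟨h1, hv.ne'⟩

theorem sum_parts (v : ℕ) (A : Set ℕ) : (parts v A).sum = (weights v A).card := by
  induction v with
  | zero => rfl
  | succ v ih =>
    by_cases hv : v ∈ A ∧ v ≠ 0
    · simp [parts_succ_of_mem hv.1 hv.2, weights_succ_of_mem hv.1, ih, card_multiset_Ico]
    · rw [parts_succ_of_notMem hv, weights_succ_of_not_and hv, ih]

theorem parts_mem_distinctPartitions (v : ℕ) (A : Set ℕ) :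
    parts v A ∈ distinctPartitions v (weights v A).card :=
  ⟨pairwise_parts v A, fun _ h => mem_parts_bounds h, sum_parts v A⟩

/-- No row of the diagram of `parts v A` extends beyond the column `v - 1`. -/
theorem add_getD_parts_lt {v : ℕ} {A : Set ℕ} {i : ℕ} (hi : i < v) :
    i + (parts v A).getD i 0 < v := by
  induction v generalizing i with
  | zero => omega
  | succ v ih =>
    by_cases hv : v ∈ A ∧ v ≠ 0
    · rw [parts_succ_of_mem hv.1 hv.2]
      rcases i with _ | i
      · simp
      · have := ih (show i < v by omega)
        rw [List.getD_cons_succ]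
        omega
    · rw [parts_succ_of_notMem hv]
      rcases (show i ≤ v by omega).lt_or_eq with hi | rfl
      · have := ih hi
        omega
      · have hlen : (parts i A).getD i 0 = 0 := by
          have : ∀ w, (parts w A).length ≤ w := by
            intro w
            induction w with
            | zero => simp [parts]
            | succ w ihw =>
              rw [parts]
              split_ifs
              · simpa using ihw
              · omega
          exact List.getD_eq_default _ _ (this i)
        omega

theorem buildGraph_iso_thresholdGraph (v : ℕ) (A : Set ℕ) :
    Nonempty (buildGraph v A ≃g thresholdGraph v (parts v A)) := by
  induction v with
  | zero => exact ⟨⟨Equiv.refl _, fun {x} => x.elim0⟩⟩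
  | succ v ih =>
    obtain ⟨f⟩ := ih
    have hbuild : ∀ x y : Fin v, (buildGraph (v + 1) A).Adj x.castSucc y.castSucc ↔
        (buildGraph v A).Adj x y := fun x y => by simp [buildGraph_adj]
    have hlast : ∀ x : Fin v, (buildGraph (v + 1) A).Adj (Fin.last v) x.castSucc ↔
        (v ∈ A ∧ v ≠ 0) := fun x => by
      have h : Fin.last v ≠ x.castSucc := (Fin.castSucc_lt_last x).ne'
      have h0 : v ≠ 0 := fun h => (h ▸ x).elim0
      simp [buildGraph_adj, h, h0]
    by_cases hv : v ∈ A ∧ v ≠ 0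
    · rw [parts_succ_of_mem hv.1 hv.2]
      refine nonempty_iso_of_option finSuccEquivLast.symm (finSuccEquiv v).symm f
        (by simpa using hbuild) (fun x y => ?_) True (fun x => ?_) fun x => ?_
      · simp only [finSuccEquiv_symm_some, thresholdGraph, Fin.succ_lt_succ_iff, Fin.val_succ,
          List.getD_cons_succ]
        omega
      · simpa [hv] using hlast x
      · simp [thresholdGraph]
    · rw [parts_succ_of_notMem hv]
      refine nonempty_iso_of_option finSuccEquivLast.symm finSuccEquivLast.symm f
        (by simpa using hbuild) (fun x y => ?_) False (fun x => ?_) fun x => ?_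
      · simp [thresholdGraph]
      · simpa [hv] using hlast x
      · have h1 := add_getD_parts_lt (A := A) x.isLt
        simp only [finSuccEquivLast_symm_some, finSuccEquivLast_symm_none, thresholdGraph,
          Fin.lt_def, Fin.val_last, Fin.val_castSucc, iff_false]
        omega

theorem count_Ico_nat (a b t : ℕ) :
    (Multiset.Ico a b).count t = if a ≤ t ∧ t < b then 1 else 0 := by
  rw [Multiset.count_eq_of_nodup (show (Multiset.Ico a b).Nodup from (Finset.Ico a b).nodup)]
  simp [Multiset.mem_Ico]

/-- The diagonal line `t` meets row `i` above the diagonal in column `t - i` if `2 * i < t`, and the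
entry there is a one if `t - i` is at most `i` plus the length of the row. -/
theorem sum_row_eq_count_weights (v : ℕ) (A : Set ℕ) (t : ℕ) :
    (∑ i ∈ Finset.range v, if 2 * i < t ∧ t ≤ 2 * i + (parts v A).getD i 0 then 1 else 0)
      = (weights v A).count t := by
  induction v generalizing t with
  | zero => simp
  | succ v ih =>
    by_cases hv : v ∈ A ∧ v ≠ 0
    · rw [parts_succ_of_mem hv.1 hv.2, weights_succ_of_mem hv.1, Finset.sum_range_succ',
        Multiset.count_add, count_Ico_nat, add_comm]
      congr 1
      · simp only [List.getD_cons_zero]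
        refine if_congr ?_ rfl rfl
        omega
      · rcases Nat.lt_or_ge t 2 with ht | ht
        · rw [Finset.sum_eq_zero fun i _ => if_neg (by omega), eq_comm, Multiset.count_eq_zero]
          intro h
          obtain ⟨s, _, hs⟩ := Multiset.mem_map.1 h
          omega
        · obtain ⟨s, rfl⟩ := Nat.exists_eq_add_of_le' ht
          rw [Multiset.count_map_eq_count' (· + 2) _ (add_left_injective 2), ← ih s]
          refine Finset.sum_congr rfl fun i _ => ?_
          rw [List.getD_cons_succ]
          refine if_congr ?_ rfl rfl
          omega
    · rw [parts_succ_of_notMem hv, weights_succ_of_not_and hv, Finset.sum_range_succ, ih,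
        Nat.add_eq_left, if_neg]
      have := add_getD_parts_lt (v := v + 1) (A := A) (Nat.lt_succ_self v)
      rw [parts_succ_of_notMem hv] at this
      omega

theorem diagonalSequence_parts (v : ℕ) (A : Set ℕ) (t : ℕ) :
    diagonalSequence v (parts v A) t = (weights v A).count t := by
  classical
  rw [← sum_row_eq_count_weights, ← Finset.card_filter, diagonalSequence]
  refine Finset.card_bij (fun p _ => (p.1 : ℕ)) ?_ ?_ ?_
  · rintro ⟨i, j⟩ h
    simp only [thresholdGraph, Finset.mem_filter, Finset.mem_univ, true_and, Fin.lt_def,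
      Finset.mem_range] at h ⊢
    have := i.isLt
    omega
  · rintro ⟨i, j⟩ h ⟨i', j'⟩ h' hi
    simp only [thresholdGraph, Finset.mem_filter, Finset.mem_univ, true_and, Fin.lt_def,
      Prod.mk.injEq, Fin.ext_iff] at h h' hi ⊢
    omega
  · intro i hi
    simp only [Finset.mem_filter, Finset.mem_range] at hi
    have := add_getD_parts_lt (A := A) hi.1
    refine ⟨(⟨i, hi.1⟩, ⟨t - i, by omega⟩), ?_, rfl⟩
    simp only [thresholdGraph, Finset.mem_filter, Finset.mem_univ, true_and, Fin.lt_def]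
    omega

theorem parts_congr {v : ℕ} {A B : Set ℕ} (h : ∀ x, 0 < x → x < v → (x ∈ A ↔ x ∈ B)) :
    parts v A = parts v B := by
  induction v with
  | zero => rfl
  | succ v ih =>
    have hv : v ∈ A ∧ v ≠ 0 ↔ v ∈ B ∧ v ≠ 0 :=
      and_congr_left fun h0 => h v (Nat.pos_of_ne_zero h0) (by omega)
    have ih := ih fun x h0 hx => h x h0 (by omega)
    by_cases hA : v ∈ A ∧ v ≠ 0
    · rw [parts_succ_of_mem hA.1 hA.2, parts_succ_of_mem (hv.1 hA).1 hA.2, ih]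
    · rw [parts_succ_of_notMem hA, parts_succ_of_notMem (mt hv.2 hA), ih]

theorem parts_eq_of_le {v w : ℕ} {A : Set ℕ} (hvw : v ≤ w)
    (h : ∀ x, v ≤ x → x < w → x ∉ A) : parts w A = parts v A := by
  induction w, hvw using Nat.le_induction with
  | base => rfl
  | succ w hw ih =>
    rw [parts_succ_of_notMem fun h' => h w hw (by omega) h'.1,
      ih fun x h1 h2 => h x h1 (by omega)]

theorem getD_parts_univ (n s : ℕ) : (parts n Set.univ).getD s 0 = n - 1 - s := by
  induction n generalizing s with
  | zero => simp [parts]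
  | succ n ih =>
    rcases Nat.eq_zero_or_pos n with rfl | hn
    · simp [parts]
    rw [parts_succ_of_mem (Set.mem_univ n) hn.ne']
    rcases s with _ | s
    · simp
    · rw [List.getD_cons_succ, ih]
      omega

/-- Row lengths of the quasi-complete graph: the first `i` rows reach the column `c`, the others stop
one column earlier. -/
theorem getD_parts_stair {c i v : ℕ} (hi : i ≤ c) (hv : c < v) (s : ℕ) :
    (parts v (stair c (c - i))).getD s 0 = if s < i then c - s else c - 1 - s := by
  rw [parts_eq_of_le (show c + 1 ≤ v from hv) fun x hx _ h => by
    have := h.2.1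
    omega]
  clear hv
  induction i generalizing c s with
  | zero =>
    rw [parts_succ_of_notMem (by simp [stair]), parts_congr (B := Set.univ) fun x h0 hx => by
      simp only [mem_stair, Set.mem_univ, iff_true]
      omega, getD_parts_univ]
    simp
  | succ i ih =>
    obtain ⟨c, rfl⟩ : ∃ d, c = d + 1 := ⟨c - 1, by omega⟩
    have hmem : c + 1 ∈ stair (c + 1) (c + 1 - (i + 1)) := ⟨by omega, le_rfl, by omega⟩
    rw [parts_succ_of_mem hmem (by omega),
      parts_congr (B := stair c (c - i)) fun x h0 hx => by
        simp only [mem_stair]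
        omega]
    rcases s with _ | s
    · simp
    · rw [List.getD_cons_succ, ih (by omega)]
      split_ifs <;> omega

/-! ### Quasi-complete and quasi-star graphs -/

theorem quasiCompleteGraph_eq {v c i : ℕ} (hi : i ≤ c) (hc : c < v) :
    quasiCompleteGraph v (weights v (stair c (c - i))).card
      = thresholdGraph v (parts v (stair c (c - i))) := by
  have hch : ∀ n : ℕ, (n + 1).choose 2 = n + n.choose 2 := fun n => by
    rw [Nat.choose_succ_succ' n 1, Nat.choose_one_right]
  have hcard : (weights v (stair c (c - i))).card = c.choose 2 + i := by
    rw [weights_stair hi hc, Multiset.card_add, card_weights_univ, card_multiset_Ico]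
    omega
  rw [hcard]
  have h1 := hch c
  have h2 := hch (c + 1)
  ext a b
  have hab : a ≠ b ↔ (a : ℕ) ≠ b := by rw [ne_eq, Fin.ext_iff]
  simp only [quasiCompleteGraph, thresholdGraph, getD_parts_stair hi hc, hab, Fin.lt_def]
  rcases hi.lt_or_eq with hi | rfl
  · obtain ⟨hk, hj⟩ := (quasiK_quasiJ_iff (c.choose 2 + i) c (c - i)).1
      ⟨by omega, by omega, by omega⟩
    rw [← hk, ← hj]
    split_ifs <;> omega
  · -- here the graph is complete on `c + 1` vertices, so that `k = j = c + 1`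
    obtain ⟨hk, hj⟩ := (quasiK_quasiJ_iff (i.choose 2 + i) (i + 1) (i + 1)).1
      ⟨by omega, by omega, by omega⟩
    rw [← hk, ← hj]
    split_ifs <;> omega

theorem quasiCompleteGraph_iso {v c i : ℕ} (hi : i ≤ c) (hc : c ≤ v - 1) :
    Nonempty (quasiCompleteGraph v (weights v (stair c (c - i))).card ≃g
      buildGraph v (stair c (c - i))) := by
  rcases Nat.eq_zero_or_pos v with rfl | hv
  · exact ⟨⟨Equiv.refl _, fun {x} => x.elim0⟩⟩
  · rw [quasiCompleteGraph_eq hi (by omega)]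
    exact (buildGraph_iso_thresholdGraph v _).map fun f => f.symm

theorem isDiagonalSequenceOf_of_iso {v : ℕ} {A B : Set ℕ} {H : SimpleGraph (Fin v)}
    (hw : weights v A = weights v B) (f : H ≃g buildGraph v B) :
    IsDiagonalSequenceOf v (weights v A).card (diagonalSequence v (parts v A)) H := by
  obtain ⟨g⟩ := buildGraph_iso_thresholdGraph v B
  refine ⟨parts v B, hw ▸ parts_mem_distinctPartitions v B, ⟨f.trans g⟩, ?_⟩
  funext t
  rw [diagonalSequence_parts, diagonalSequence_parts, hw]

theorem theorem2p1 (v e : ℕ) (G : SimpleGraph (Fin v)) (hG : IsOptimal v e G) :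
    ∃ π ∈ distinctPartitions v e, Nonempty (G ≃g thresholdGraph v π) ∧
      (IsDiagonalSequenceOf v e (diagonalSequence v π) (quasiStarGraph v e) ∨
        IsDiagonalSequenceOf v e (diagonalSequence v π) (quasiCompleteGraph v e)) := by
  obtain ⟨A, ⟨f⟩⟩ := hG.nestedNeighbors.exists_iso_buildGraph (Nat.card_fin v)
  obtain ⟨g⟩ := buildGraph_iso_thresholdGraph v A
  have he : e = (weights v A).card := by
    rw [← ncard_edgeSet_buildGraph, ← ncard_edgeSet_congr f]
    exact hG.1.symm
  obtain ⟨c, i, hi, hc, h⟩ := (hG.maximalWeight f).exists_stair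
  obtain ⟨q⟩ := quasiCompleteGraph_iso hi hc
  rw [he]
  refine ⟨parts v A, parts_mem_distinctPartitions v A, ⟨f.trans g⟩, ?_⟩
  rcases h with h | h
  · right
    rw [← h] at q
    exact isDiagonalSequenceOf_of_iso h q
  · left
    have hcard : v.choose 2 - (weights v A).card = (weights v (stair c (c - i))).card := by
      have := card_weights_add_card_compl v (stair c (c - i))
      rw [h]
      omega
    refine isDiagonalSequenceOf_of_iso h ?_
    rw [← buildGraph_compl, quasiStarGraph, hcard]
    exact ⟨q.toEquiv, fun {a b} => by
      simp only [SimpleGraph.compl_adj, ne_eq, EmbeddingLike.apply_eq_iff_eq]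
      exact and_congr Iff.rfl (not_congr q.map_rel_iff)⟩
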